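/- A trigonometric polynomial is a function $\mu(\mathbf r)=\sum_{\mathbf k\in\Lambda}c[\mathbf k]\,e^{2\pi i\langle \mathbf k,\mathbf r\rangle}$ on $\mathbb R^2$ with $\Lambda\subset\mathbb Z^2$ finite and $c[\mathbf k]\in\mathbb C$. Its degree $\deg(\mu)=(K,L)$ is the pair of side lengths (counted in integer points) of the smallest rectangle in $\mathbb Z^2$ containing $\{\mathbf k : c[\mathbf k]\ne 0\}$; degrees are compared componentwise. We write $\nu\mid\mu$ if $\mu=\nu\gamma$ for some trigonometric polynomial $\gamma$. A trigonometric curve is the zero set $C=\{\mathbf r\in[0,1]^2:\mu(\mathbf r)=0\}$ of a trigonometric polynomial $\mu\not\equiv0$. A trigonometric polynomial $\mu_0$ is a minimal polynomial of $C$ if its zero set in $[0,1]^2$ is $C$ and every trigonometric polynomial $\mu$ whose zero set in $[0,1]^2$ is $C$ satisfies $\deg(\mu_0)\le\deg(\mu)$ and $\mu_0\mid\mu$. **Proposition.** Let $C$ be a trigonometric curve with minimal polynomial $\mu_0$. If $\nu$ is a trigonometric polynomial such that $\nu=0$ and $\nabla\nu=0$ at every point of $C$, then $\mu_0^2\mid\nu$.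 Moreover, $\nabla\mu_0=0$ at no more than finitely many points of $C$. -/

import Mathlib

/-- A trigonometric polynomial in two variables, given by its finitely many nonzero Fourier
coefficients `c k ∈ ℂ`, `k ∈ ℤ²`. -/
structure TrigPoly where
  coeff : ℤ × ℤ →₀ ℂ

namespace TrigPoly

/-- The function `r ↦ ∑ k, c k * exp (2πi ⟨k, r⟩)` (`1`-periodic in both variables). -/
noncomputable def eval (μ : TrigPoly) (r : ℝ × ℝ) : ℂ :=
  μ.coeff.sum fun k a =>
    a * Complex.exp (2 * (Real.pi : ℂ) * Complex.I * ((k.1 : ℂ) * (r.1 : ℂ) + (k.2 : ℂ) * (r.2 : ℂ)))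

/-- The zero set in the unit square `[0,1]²`. -/
def zeroSet (μ : TrigPoly) : Set (ℝ × ℝ) :=
  {r | r ∈ Set.Icc (0 : ℝ) 1 ×ˢ Set.Icc (0 : ℝ) 1 ∧ μ.eval r = 0}

/-- The number of integers in the shortest interval of integers that contains `S`. -/
noncomputable def width (S : Set ℤ) : ℕ :=
  sInf {n : ℕ | ∃ a : ℤ, S ⊆ Set.Ico a (a + n)}

/-- The degree `(K, L)`: the dimensions of the smallest rectangle in `ℤ²` that contains the
frequency support. Degrees are compared componentwise. -/
noncomputable def deg (μ : TrigPoly) : ℕ × ℕ :=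
  (width {i | ∃ k, μ.coeff k ≠ 0 ∧ k.1 = i}, width {j | ∃ k, μ.coeff k ≠ 0 ∧ k.2 = j})

/-- The function `f` divides the function `g`, with a trigonometric polynomial as quotient. -/
def Divides (f g : ℝ × ℝ → ℂ) : Prop :=
  ∃ γ : TrigPoly, ∀ r, g r = f r * γ.eval r

/-- The gradient `(∂f/∂x, ∂f/∂y)` of a complex-valued function on `ℝ²`. -/
noncomputable def grad (f : ℝ × ℝ → ℂ) (r : ℝ × ℝ) : ℂ × ℂ :=
  (deriv (fun x : ℝ => f (x, r.2)) r.1, deriv (fun y : ℝ => f (r.1, y)) r.2)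

/-- A trigonometric curve: the zero set of a trigonometric polynomial that is not the zero
polynomial. -/
def IsTrigCurve (C : Set (ℝ × ℝ)) : Prop :=
  ∃ μ : TrigPoly, μ.coeff ≠ 0 ∧ μ.zeroSet = C

/-- `μ₀` is a minimal polynomial of `C`: its zero set is `C`, and every trigonometric polynomial
with zero set `C` has at least the degree of `μ₀` and is divisible by `μ₀`. -/
def IsMinimalPoly (C : Set (ℝ × ℝ)) (μ₀ : TrigPoly) : Prop :=
  μ₀.zeroSet = C ∧
    ∀ μ : TrigPoly, μ.zeroSet = C → μ₀.deg ≤ μ.deg ∧ Divides μ₀.eval μ.eval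

end TrigPoly

/-! Trigonometric polynomials form the Laurent ring in two variables, a Noetherian UFD of dimension
at most 2. There a prime `p` and an `f` not divisible by `p` have finitely many common zeros
(`finite_zeros_inter`). Let `m` be the minimal polynomial. It is squarefree, since a repeated factor
could be dropped, and each prime factor has infinitely many zeros (`infinite_zeros_of_minimal`),
since otherwise it could be exchanged for another polynomial with the same zeros. Hence `m` divides
everything that vanishes on the curve. If the gradient of `f = m * g` vanishes there too, every
prime `p ∣ m` divides both derivatives of `m` times `g`. No prime divides both its own derivatives
(`isUnit_of_dvd_der`), so `p ∣ g`, and thus `m ∣ g`. The same fact shows that `p` misses some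
derivative of `m`, so singular points are finite in number. -/

/-- The ring of Laurent polynomials in two variables. -/
abbrev Laurent₂ : Type := AddMonoidAlgebra ℂ (ℤ × ℤ)

/-! ### Dimension and factoriality of Laurent rings -/

theorem ringKrullDim_le_of_isLocalization {R : Type*} (S : Type*) [CommRing R] [CommRing S]
    [Algebra R S] (M : Submonoid R) [IsLocalization M S] : ringKrullDim S ≤ ringKrullDim R := by
  refine Order.krullDim_le_of_strictMono (PrimeSpectrum.comap (algebraMap R S)) ?_
  refine Monotone.strictMono_of_injective (fun a b h => ?_)
    (PrimeSpectrum.localization_comap_injective S M)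
  exact Ideal.comap_mono h

theorem ringKrullDim_laurentPolynomial_le (R : Type*) [CommRing R] [IsNoetherianRing R] :
    ringKrullDim (LaurentPolynomial R) ≤ ringKrullDim R + 1 :=
  (ringKrullDim_le_of_isLocalization _ (Submonoid.powers (Polynomial.X : Polynomial R))).trans
    Polynomial.ringKrullDim_of_isNoetherianRing.le

theorem isNoetherianRing_laurentPolynomial (R : Type*) [CommRing R] [IsNoetherianRing R] :
    IsNoetherianRing (LaurentPolynomial R) :=
  IsLocalization.isNoetherianRing (Submonoid.powers (Polynomial.X : Polynomial R)) _ inferInstance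

theorem uniqueFactorizationMonoid_laurentPolynomial (R : Type*) [CommRing R] [IsDomain R]
    [UniqueFactorizationMonoid R] : UniqueFactorizationMonoid (LaurentPolynomial R) :=
  UniqueFactorizationMonoid.of_isLocalization (Submonoid.powers (Polynomial.X : Polynomial R)) _

namespace Laurent₂

/-- Laurent polynomials in two variables as Laurent polynomials over Laurent polynomials. -/
noncomputable def curryEquiv : Laurent₂ ≃+* LaurentPolynomial (LaurentPolynomial ℂ) :=
  AddMonoidAlgebra.curryRingEquiv

noncomputable instance : IsNoetherianRing Laurent₂ :=
  have := isNoetherianRing_laurentPolynomial ℂ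
  have := isNoetherianRing_laurentPolynomial (LaurentPolynomial ℂ)
  isNoetherianRing_of_ringEquiv _ curryEquiv.symm

instance : IsDomain Laurent₂ := NoZeroDivisors.to_isDomain _

instance : UniqueFactorizationMonoid Laurent₂ :=
  have := uniqueFactorizationMonoid_laurentPolynomial ℂ
  have : IsDomain (LaurentPolynomial ℂ) := NoZeroDivisors.to_isDomain _
  have := uniqueFactorizationMonoid_laurentPolynomial (LaurentPolynomial ℂ)
  MulEquiv.uniqueFactorizationMonoid curryEquiv.symm.toMulEquiv inferInstance

theorem ringKrullDim_le : ringKrullDim Laurent₂ ≤ 2 := by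
  have := isNoetherianRing_laurentPolynomial ℂ
  rw [ringKrullDim_eq_of_ringEquiv curryEquiv]
  refine (ringKrullDim_laurentPolynomial_le _).trans ?_
  calc _ ≤ ringKrullDim ℂ + 1 + 1 := by
        gcongr
        exact ringKrullDim_laurentPolynomial_le ℂ
    _ = 2 := by rw [ringKrullDim_eq_zero_of_field]; norm_num

end Laurent₂

/-- Dividing by `p` and then by the image of `f` lowers the dimension by at least one each time.
What remains is Artinian, with finitely many primes. -/
theorem finite_primeSpectrum_quotient_span_pair {R : Type*} [CommRing R] [IsDomain R]
    [IsNoetherianRing R] (hR : ringKrullDim R ≤ 2) {p f : R} (hp : Prime p) (hf : ¬ p ∣ f) :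
    {q : PrimeSpectrum R | p ∈ q.asIdeal ∧ f ∈ q.asIdeal}.Finite := by
  let I : Ideal R := Ideal.span {p}
  have : I.IsPrime := (Ideal.span_singleton_prime hp.ne_zero).2 hp
  let f' : R ⧸ I := Ideal.Quotient.mk I f
  have hf' : f' ≠ 0 := by
    rw [Ne, Ideal.Quotient.eq_zero_iff_mem, Ideal.mem_span_singleton]
    exact hf
  let J : Ideal (R ⧸ I) := Ideal.span {f'}
  have h1 : ringKrullDim (R ⧸ I) + 1 ≤ ringKrullDim R :=
    ringKrullDim_quotient_succ_le_of_nonZeroDivisor (mem_nonZeroDivisors_of_ne_zero hp.ne_zero)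
  have h2 : ringKrullDim ((R ⧸ I) ⧸ J) + 1 ≤ ringKrullDim (R ⧸ I) :=
    ringKrullDim_quotient_succ_le_of_nonZeroDivisor (mem_nonZeroDivisors_of_ne_zero hf')
  have h3 : ringKrullDim ((R ⧸ I) ⧸ J) ≤ 0 := by
    have h : ringKrullDim ((R ⧸ I) ⧸ J) + 1 + 1 ≤ 2 := by
      refine le_trans ?_ (h1.trans hR)
      gcongr
    generalize ringKrullDim ((R ⧸ I) ⧸ J) = d at h
    by_contra! hd
    have h1d : 1 ≤ d := by
      cases d with
      | bot => exact absurd hd (by decide)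
      | coe d => exact WithBot.coe_le_coe.2 (Order.one_le_iff_pos.2 (WithBot.coe_lt_coe.1 hd))
    have h3 : (1 : WithBot ℕ∞) + 1 + 1 ≤ 2 := le_trans (by gcongr) h
    exact absurd h3 (by decide)
  have : Ring.KrullDimLE 0 ((R ⧸ I) ⧸ J) := by
    rw [Ring.KrullDimLE, Order.krullDimLE_iff]
    exact h3
  have : IsArtinianRing ((R ⧸ I) ⧸ J) :=
    isArtinianRing_iff_isNoetherianRing_krullDimLE_zero.2 ⟨inferInstance, inferInstance⟩
  let π : R →+* ((R ⧸ I) ⧸ J) := (Ideal.Quotient.mk J).comp (Ideal.Quotient.mk I)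
  have hπ : Function.Surjective π :=
    Ideal.Quotient.mk_surjective.comp Ideal.Quotient.mk_surjective
  refine (Set.finite_range (PrimeSpectrum.comap π)).subset ?_
  rintro q ⟨hpq, hfq⟩
  rw [range_comap_of_surjective _ _ hπ, PrimeSpectrum.mem_zeroLocus]
  intro x hx
  have hx : Ideal.Quotient.mk J (Ideal.Quotient.mk I x) = 0 := hx
  rw [Ideal.Quotient.eq_zero_iff_mem, Ideal.mem_span_singleton] at hx
  obtain ⟨y, hy⟩ := hx
  obtain ⟨y, rfl⟩ := Ideal.Quotient.mk_surjective y
  rw [← map_mul, Ideal.Quotient.eq, Ideal.mem_span_singleton] at hy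
  obtain ⟨z, hz⟩ := hy
  rw [sub_eq_iff_eq_add.1 hz]
  exact q.asIdeal.add_mem (q.asIdeal.mul_mem_right _ hpq) (q.asIdeal.mul_mem_right _ hfq)

/-- Since `a - φ a` lies in the kernel of `φ`, the kernel determines `φ`; points can thus be counted
by primes. -/
theorem AlgHom.eq_of_ker_le {k A : Type*} [CommRing k] [CommRing A] [Algebra k A]
    {φ ψ : A →ₐ[k] k} (h : RingHom.ker φ ≤ RingHom.ker ψ) : φ = ψ := by
  ext a
  have := h (show a - algebraMap k A (φ a) ∈ RingHom.ker φ by simp [RingHom.mem_ker])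
  rw [RingHom.mem_ker, map_sub, AlgHom.commutes, sub_eq_zero] at this
  exact this.symm

theorem finite_algHom_of_not_dvd {k R : Type*} [Field k] [CommRing R] [IsDomain R] [Algebra k R]
    [IsNoetherianRing R] (hR : ringKrullDim R ≤ 2) {p f : R} (hp : Prime p) (hf : ¬ p ∣ f) :
    {φ : R →ₐ[k] k | φ p = 0 ∧ φ f = 0}.Finite := by
  refine Set.Finite.of_injOn (f := fun φ => (⟨RingHom.ker φ, RingHom.ker_isPrime _⟩ : PrimeSpectrum R))
    ?_ ?_ (finite_primeSpectrum_quotient_span_pair hR hp hf)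
  · intro φ h
    exact h
  · intro φ _ ψ _ h
    exact AlgHom.eq_of_ker_le (PrimeSpectrum.ext_iff.1 h).le

/-! ### Derivations of the Laurent ring -/

namespace Laurent₂

open AddMonoidAlgebra

/-- The additive map scaling the monomial with exponent `k` by `ℓ k`. -/
noncomputable def der (ℓ : ℤ × ℤ →+ ℤ) : Laurent₂ →+ Laurent₂ :=
  (coeffAddEquiv.symm : (ℤ × ℤ →₀ ℂ) ≃+ Laurent₂).toAddMonoidHom.comp
    ((Finsupp.liftAddHom fun k =>
      (Finsupp.singleAddHom k).comp (AddMonoidHom.mulLeft (ℓ k : ℂ))).comp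
        (coeffAddEquiv : Laurent₂ ≃+ (ℤ × ℤ →₀ ℂ)).toAddMonoidHom)

@[simp]
theorem der_single (ℓ : ℤ × ℤ →+ ℤ) (k : ℤ × ℤ) (a : ℂ) :
    der ℓ (single k a) = single k (ℓ k * a) := by
  ext
  simp [der]

theorem coeff_der (ℓ : ℤ × ℤ →+ ℤ) (f : Laurent₂) (k : ℤ × ℤ) :
    (der ℓ f).coeff k = ℓ k * f.coeff k := by
  induction f using induction_linear with
  | zero => simp
  | add f g hf hg => rw [map_add, coeff_add, Finsupp.add_apply, hf, hg, coeff_add,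
      Finsupp.add_apply, mul_add]
  | single m r =>
    rw [der_single, coeff_single, coeff_single]
    by_cases h : m = k
    · subst h; simp
    · simp [h]

theorem der_mul (ℓ : ℤ × ℤ →+ ℤ) (f g : Laurent₂) :
    der ℓ (f * g) = der ℓ f * g + f * der ℓ g := by
  induction f using induction_linear with
  | zero => simp
  | add f f' hf hf' => rw [add_mul, map_add, map_add, hf, hf']; ring
  | single m r =>
    induction g using induction_linear with
    | zero => simp
    | add g g' hg hg' => rw [mul_add, map_add, map_add, hg, hg']; ring
    | single n s =>
      rw [single_mul_single, der_single, der_single, der_single, single_mul_single,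
        single_mul_single, ← single_add]
      congr 1
      push_cast [map_add]
      ring

theorem isUnit_single (k : ℤ × ℤ) {a : ℂ} (ha : a ≠ 0) : IsUnit (single k a : Laurent₂) := by
  refine IsUnit.of_mul_eq_one (single (-k) a⁻¹) ?_
  rw [single_mul_single, add_neg_cancel, mul_inv_cancel₀ ha]
  rfl

/-- A nonzero ideal stable under both derivations contains a monomial. -/
theorem eq_top_of_der_mem (J : Ideal Laurent₂)
    (h1 : ∀ f ∈ J, der (AddMonoidHom.fst ℤ ℤ) f ∈ J)
    (h2 : ∀ f ∈ J, der (AddMonoidHom.snd ℤ ℤ) f ∈ J)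
    (f : Laurent₂) (hf : f ∈ J) (hf0 : f ≠ 0) : J = ⊤ := by
  induction hn : f.coeff.support.card using Nat.strong_induction_on generalizing f with
  | _ n ih =>
    by_cases hs : ∃ k ∈ f.coeff.support, ∃ k' ∈ f.coeff.support, k ≠ k'
    · obtain ⟨k, hk, k', hk', hne⟩ := hs
      have key : ∀ ℓ : ℤ × ℤ →+ ℤ, der ℓ f ∈ J → ℓ k ≠ ℓ k' → J = ⊤ := by
        intro ℓ hℓ hkk
        -- This combination kills the term at `k'` and keeps the one at `k`, so the support shrinks
        -- but stays nonempty.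
        set g : Laurent₂ := der ℓ f - (ℓ k' : ℤ) • f with hg
        have hc : ∀ i, g.coeff i = ((ℓ i : ℂ) - ℓ k') * f.coeff i := by
          intro i
          have : g.coeff i = (der ℓ f).coeff i - (ℓ k' : ℤ) • f.coeff i := rfl
          rw [this, coeff_der, zsmul_eq_mul]
          ring
        refine ih _ ?_ g (J.sub_mem hℓ (zsmul_mem hf _)) ?_ rfl
        · rw [← hn]
          refine Finset.card_lt_card (Finset.ssubset_iff_subset_ne.2 ⟨fun i hi => ?_, fun he => ?_⟩)
          · rw [Finsupp.mem_support_iff, hc] at hi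
            exact Finsupp.mem_support_iff.2 (right_ne_zero_of_mul hi)
          · rw [← he, Finsupp.mem_support_iff, hc] at hk'
            simp at hk'
        · intro h0
          have := hc k
          rw [h0, coeff_zero, Finsupp.zero_apply, eq_comm, mul_eq_zero, sub_eq_zero] at this
          exact this.elim (fun h => hkk (by exact_mod_cast h)) (Finsupp.mem_support_iff.1 hk)
      by_cases h : k.1 = k'.1
      · exact key _ (h2 f hf) fun h' => hne (Prod.ext h h')
      · exact key _ (h1 f hf) h
    · push Not at hs
      obtain ⟨k, hk⟩ := Finsupp.support_nonempty_iff.2 (fun h => hf0 (coeff_eq_zero.1 h))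
      have : f = single k (f.coeff k) := by
        ext i
        rw [coeff_single]
        by_cases hi : k = i
        · subst hi; simp
        · rw [Finsupp.single_eq_of_ne' hi]
          by_contra h0
          exact hi (hs k hk i (Finsupp.mem_support_iff.2 h0))
      rw [this] at hf
      exact J.eq_top_of_isUnit_mem hf (isUnit_single k (Finsupp.mem_support_iff.1 hk))

theorem isUnit_of_dvd_der {p : Laurent₂} (hp : p ≠ 0)
    (h1 : p ∣ der (AddMonoidHom.fst ℤ ℤ) p) (h2 : p ∣ der (AddMonoidHom.snd ℤ ℤ) p) :
    IsUnit p := by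
  rw [← Ideal.span_singleton_eq_top]
  have key : ∀ ℓ, p ∣ der ℓ p → ∀ f ∈ Ideal.span {p}, der ℓ f ∈ Ideal.span {p} := by
    intro ℓ h f hf
    rw [Ideal.mem_span_singleton] at hf ⊢
    obtain ⟨g, rfl⟩ := hf
    rw [der_mul]
    exact dvd_add (h.mul_right _) (dvd_mul_right _ _)
  exact eq_top_of_der_mem _ (key _ h1) (key _ h2) p (Ideal.mem_span_singleton_self p) hp

/-! ### Evaluation on the torus -/

/-- The monomial function with exponent `k` at a point of the torus. -/
noncomputable def char (r : ℝ × ℝ) : Multiplicative (ℤ × ℤ) →* ℂ where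
  toFun k := Complex.exp (2 * (Real.pi : ℂ) * Complex.I *
    ((k.toAdd.1 : ℂ) * (r.1 : ℂ) + (k.toAdd.2 : ℂ) * (r.2 : ℂ)))
  map_one' := by simp
  map_mul' k l := by
    rw [← Complex.exp_add]
    congr 1
    simp only [toAdd_mul, Prod.fst_add, Prod.snd_add]
    push_cast
    ring

/-- Evaluation at a point of the torus. -/
noncomputable def ev (r : ℝ × ℝ) : Laurent₂ →ₐ[ℂ] ℂ :=
  lift ℂ ℂ (ℤ × ℤ) (char r)

theorem ev_single (r : ℝ × ℝ) (k : ℤ × ℤ) (a : ℂ) :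
    ev r (single k a) = a * Complex.exp (2 * (Real.pi : ℂ) * Complex.I *
      ((k.1 : ℂ) * (r.1 : ℂ) + (k.2 : ℂ) * (r.2 : ℂ))) :=
  lift_single _ _ _

theorem ev_ofCoeff (μ : TrigPoly) (r : ℝ × ℝ) : ev r (ofCoeff μ.coeff) = μ.eval r :=
  lift_apply _ _

/-- Two integer frequencies agree if their characters of `ℝ` agree. -/
theorem int_eq_of_exp_eq {m n : ℤ}
    (h : ∀ t : ℝ, Complex.exp (2 * (Real.pi : ℂ) * Complex.I * (m * t)) =
      Complex.exp (2 * (Real.pi : ℂ) * Complex.I * (n * t))) : m = n := by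
  by_contra hne
  have hne' : ((m : ℂ) - n) ≠ 0 := sub_ne_zero.2 (by exact_mod_cast hne)
  -- At `t = 1 / (2 (m - n))` the two values differ by the factor `exp (π i) = -1`.
  obtain ⟨j, hj⟩ := Complex.exp_eq_exp_iff_exists_int.1 (h ((2 * ((m : ℝ) - n))⁻¹))
  have h2 : (2 * (Real.pi : ℂ) * Complex.I) * (((m : ℂ) - n) * (2 * ((m : ℂ) - n))⁻¹) =
      (2 * (Real.pi : ℂ) * Complex.I) * j := by
    push_cast at hj
    linear_combination hj
  have h3 := mul_left_cancel₀ Complex.two_pi_I_ne_zero h2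
  rw [mul_inv, mul_left_comm, mul_inv_cancel₀ hne', mul_one] at h3
  have h4 : (1 : ℂ) = ((2 * j : ℤ) : ℂ) := by push_cast; rw [← h3]; norm_num
  have h5 : (1 : ℤ) = 2 * j := by exact_mod_cast h4
  omega

/-- The character of `ℝ²` with frequency `k`. -/
noncomputable def freq (k : ℤ × ℤ) : Multiplicative (ℝ × ℝ) →* ℂ where
  toFun r := char r.toAdd (Multiplicative.ofAdd k)
  map_one' := by simp [char]
  map_mul' r s := by
    simp only [char, MonoidHom.coe_mk, OneHom.coe_mk, toAdd_mul, Prod.fst_add, Prod.snd_add]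
    rw [← Complex.exp_add]
    congr 1
    push_cast
    ring

theorem freq_injective : Function.Injective freq := by
  intro k l h
  have h' : ∀ x y : ℝ, freq k (Multiplicative.ofAdd (x, y)) = freq l (Multiplicative.ofAdd (x, y)) :=
    fun x y => by rw [h]
  refine Prod.ext (int_eq_of_exp_eq fun t => ?_) (int_eq_of_exp_eq fun t => ?_)
  · simpa [freq, char] using h' t 0
  · simpa [freq, char] using h' 0 t

/-- Distinct characters are linearly independent (Dedekind). -/
theorem eq_zero_of_ev {f : Laurent₂} (h : ∀ r, ev r f = 0) : f = 0 := by
  have hli := (linearIndependent_monoidHom (Multiplicative (ℝ × ℝ)) ℂ).comp freq freq_injective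
  rw [← coeff_eq_zero]
  refine linearIndependent_iff.1 hli _ ?_
  ext r
  rw [Finsupp.linearCombination_apply, Finsupp.sum_apply']
  refine Eq.trans ?_ (h r.toAdd)
  rw [ev, lift_apply]
  rfl

theorem eq_of_ev {f g : Laurent₂} (h : ∀ r, ev r f = ev r g) : f = g :=
  sub_eq_zero.1 (eq_zero_of_ev fun r => by rw [map_sub, h, sub_self])

theorem exists_int_of_ev_eq {r s : ℝ × ℝ} (h : ev r = ev s) :
    (∃ m : ℤ, r.1 = s.1 + m) ∧ ∃ n : ℤ, r.2 = s.2 + n := by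
  have key : ∀ x y : ℝ, Complex.exp (2 * (Real.pi : ℂ) * Complex.I * x) =
      Complex.exp (2 * (Real.pi : ℂ) * Complex.I * y) → ∃ m : ℤ, x = y + m := by
    intro x y hxy
    obtain ⟨m, hm⟩ := Complex.exp_eq_exp_iff_exists_int.1 hxy
    refine ⟨m, ?_⟩
    have : (2 * (Real.pi : ℂ) * Complex.I) * x = (2 * (Real.pi : ℂ) * Complex.I) * (y + m) := by
      rw [hm]; ring
    exact_mod_cast mul_left_cancel₀ Complex.two_pi_I_ne_zero this
  constructor
  · have := DFunLike.congr_fun h (single (1, 0) 1)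
    exact key _ _ (by simpa [ev_single] using this)
  · have := DFunLike.congr_fun h (single (0, 1) 1)
    exact key _ _ (by simpa [ev_single] using this)

/-- The zero set in the unit square. -/
def zeros (f : Laurent₂) : Set (ℝ × ℝ) :=
  {r | r ∈ Set.Icc (0 : ℝ) 1 ×ˢ Set.Icc (0 : ℝ) 1 ∧ ev r f = 0}

theorem finite_zeros_inter {p f : Laurent₂} (hp : Prime p) (hf : ¬ p ∣ f) :
    (zeros p ∩ zeros f).Finite := by
  have hfin := finite_algHom_of_not_dvd (k := ℂ) ringKrullDim_le hp hf
  -- Evaluation sees a point only modulo `ℤ²`; the floors, each 0 or 1, separate opposite edges of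
  -- the square.
  refine Set.Finite.of_injOn (f := fun r : ℝ × ℝ => (ev r, ⌊r.1⌋, ⌊r.2⌋)) (t :=
    {φ : Laurent₂ →ₐ[ℂ] ℂ | φ p = 0 ∧ φ f = 0} ×ˢ (Set.Icc 0 1 ×ˢ Set.Icc 0 1)) ?_ ?_
    (hfin.prod ((Set.finite_Icc _ _).prod (Set.finite_Icc _ _)))
  · rintro r ⟨⟨⟨h1, h2⟩, hrp⟩, ⟨-, hrf⟩⟩
    have key : ∀ x ∈ Set.Icc (0 : ℝ) 1, ⌊x⌋ ∈ Set.Icc (0 : ℤ) 1 := fun x hx =>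
      ⟨Int.floor_nonneg.2 hx.1, by simpa using Int.floor_mono hx.2⟩
    exact ⟨⟨hrp, hrf⟩, key _ h1, key _ h2⟩
  · rintro r - s - h
    simp only [Prod.mk.injEq] at h
    obtain ⟨h, h1, h2⟩ := h
    obtain ⟨⟨m, hm⟩, n, hn⟩ := exists_int_of_ev_eq h
    rw [hm, Int.floor_add_intCast] at h1
    rw [hn, Int.floor_add_intCast] at h2
    have hm0 : m = 0 := by omega
    have hn0 : n = 0 := by omega
    subst hm0 hn0
    exact Prod.ext (by simpa using hm) (by simpa using hn)

theorem hasDerivAt_fst (f : Laurent₂) (r : ℝ × ℝ) :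
    HasDerivAt (fun x : ℝ => ev (x, r.2) f)
      (2 * (Real.pi : ℂ) * Complex.I * ev r (der (AddMonoidHom.fst ℤ ℤ) f)) r.1 := by
  induction f using induction_linear with
  | zero => simpa using hasDerivAt_const r.1 (0 : ℂ)
  | add f g hf hg => simpa [mul_add] using! hf.add hg
  | single k a =>
    simp only [der_single, ev_single]
    have h := ((((((hasDerivAt_id r.1).ofReal_comp).const_mul (k.1 : ℂ)).add_const
      ((k.2 : ℂ) * r.2)).const_mul (2 * (Real.pi : ℂ) * Complex.I)).cexp).const_mul a
    refine h.congr_deriv ?_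
    simp only [id, AddMonoidHom.coe_fst, Complex.ofReal_one]
    ring

theorem hasDerivAt_snd (f : Laurent₂) (r : ℝ × ℝ) :
    HasDerivAt (fun y : ℝ => ev (r.1, y) f)
      (2 * (Real.pi : ℂ) * Complex.I * ev r (der (AddMonoidHom.snd ℤ ℤ) f)) r.2 := by
  induction f using induction_linear with
  | zero => simpa using hasDerivAt_const r.2 (0 : ℂ)
  | add f g hf hg => simpa [mul_add] using! hf.add hg
  | single k a =>
    simp only [der_single, ev_single]
    have h := ((((((hasDerivAt_id r.2).ofReal_comp).const_mul (k.2 : ℂ)).const_add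
      ((k.1 : ℂ) * r.1)).const_mul (2 * (Real.pi : ℂ) * Complex.I)).cexp).const_mul a
    refine h.congr_deriv ?_
    simp only [id, AddMonoidHom.coe_snd, Complex.ofReal_one]
    ring

theorem grad_eq_zero_iff (μ : TrigPoly) (r : ℝ × ℝ) : TrigPoly.grad μ.eval r = 0 ↔
    ev r (der (AddMonoidHom.fst ℤ ℤ) (ofCoeff μ.coeff)) = 0 ∧
      ev r (der (AddMonoidHom.snd ℤ ℤ) (ofCoeff μ.coeff)) = 0 := by
  have h : TrigPoly.eval μ = fun r => ev r (ofCoeff μ.coeff) := funext fun r => (ev_ofCoeff μ r).symm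
  rw [TrigPoly.grad, h, (hasDerivAt_fst _ r).deriv, (hasDerivAt_snd _ r).deriv, Prod.mk_eq_zero,
    mul_eq_zero_iff_left Complex.two_pi_I_ne_zero, mul_eq_zero_iff_left Complex.two_pi_I_ne_zero]

end Laurent₂

/-! ### Polynomials vanishing at a single torus point -/

namespace Laurent₂

open AddMonoidAlgebra

/-- The binomial with exponents `k` and `0` that vanishes at `r`. -/
noncomputable def binom (k : ℤ × ℤ) (r : ℝ × ℝ) : Laurent₂ :=
  single k 1 - single 0 (ev r (single k 1))

theorem ev_single_neg (r : ℝ × ℝ) (k : ℤ × ℤ) :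
    ev r (single (-k) 1) = (starRingEnd ℂ) (ev r (single k 1)) := by
  simp only [ev_single, one_mul, ← Complex.exp_conj, map_mul, map_add, map_ofNat, map_intCast,
    Complex.conj_I, Complex.conj_ofReal, Prod.fst_neg, Prod.snd_neg, Int.cast_neg]
  congr 1
  ring

theorem ev_binom (k : ℤ × ℤ) (r s : ℝ × ℝ) :
    ev s (binom k r) = ev s (single k 1) - ev r (single k 1) := by
  rw [binom, map_sub, ev_single s 0]
  simp

/-- With `z` the monomial and `w` its value at `r`, `z - w = -w z (z⁻¹ - w⁻¹)`. -/
theorem binom_neg_dvd (k : ℤ × ℤ) (r : ℝ × ℝ) : binom (-k) r ∣ binom k r := by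
  refine ⟨-single k (ev r (single k 1)), eq_of_ev fun s => ?_⟩
  have h1 : ∀ t, ev t (single k 1) * ev t (single (-k) 1) = 1 := by
    intro t
    rw [← map_mul, single_mul_single, add_neg_cancel, mul_one]
    exact map_one (ev t)
  have h2 : ev s (single k (ev r (single k 1))) = ev r (single k 1) * ev s (single k 1) := by
    rw [ev_single, ev_single s, one_mul]
  rw [map_mul, map_neg, h2, ev_binom, ev_binom]
  linear_combination ev r (single k 1) * h1 s - ev s (single k 1) * h1 r

/-- The squared absolute value of `binom k r`. -/
noncomputable def absSq (k : ℤ × ℤ) (r : ℝ × ℝ) : Laurent₂ :=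
  binom k r * binom (-k) r

theorem ev_absSq (k : ℤ × ℤ) (r s : ℝ × ℝ) :
    ev s (absSq k r) = Complex.normSq (ev s (single k 1) - ev r (single k 1)) := by
  rw [absSq, map_mul, ev_binom, ev_binom, ev_single_neg, ev_single_neg, ← map_sub,
    Complex.mul_conj]

theorem dvd_binom_of_dvd_absSq {p : Laurent₂} (hp : Prime p) {k : ℤ × ℤ} {r : ℝ × ℝ}
    (h : p ∣ absSq k r) : p ∣ binom k r :=
  (hp.dvd_or_dvd h).elim id fun h => h.trans (binom_neg_dvd k r)

/-- On the torus, this vanishes exactly at the point `r`. -/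
noncomputable def pointPoly (n : ℕ) (r : ℝ × ℝ) : Laurent₂ :=
  absSq (1, 0) r + (n + 1 : ℂ) • absSq (0, 1) r

theorem ev_pointPoly_eq_zero {n : ℕ} {r s : ℝ × ℝ} :
    ev s (pointPoly n r) = 0 ↔ ev s = ev r := by
  rw [pointPoly, map_add, map_smul, ev_absSq, ev_absSq, smul_eq_mul]
  constructor
  · intro h
    have h' : Complex.normSq (ev s (single (1, 0) 1) - ev r (single (1, 0) 1)) + ((n : ℝ) + 1) *
      Complex.normSq (ev s (single (0, 1) 1) - ev r (single (0, 1) 1)) = 0 := by exact_mod_cast h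
    have hn : (0 : ℝ) < (n : ℝ) + 1 := by positivity
    have h1 := Complex.normSq_nonneg (ev s (single (1, 0) 1) - ev r (single (1, 0) 1))
    have h2 := mul_nonneg hn.le
      (Complex.normSq_nonneg (ev s (single (0, 1) 1) - ev r (single (0, 1) 1)))
    obtain ⟨e1, e2⟩ := (add_eq_zero_iff_of_nonneg h1 h2).1 h'
    have e2 := (mul_eq_zero_iff_left hn.ne').1 e2
    rw [Complex.normSq_eq_zero, sub_eq_zero] at e1 e2
    refine AddMonoidAlgebra.algHom_ext (fun k => ?_) (Subsingleton.elim _ _)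
    have hk : ∀ t, ev t (single k 1) =
        ev t (single (1, 0) 1) ^ k.1 * ev t (single (0, 1) 1) ^ k.2 := by
      intro t
      simp only [ev_single, one_mul, ← Complex.exp_int_mul, ← Complex.exp_add]
      congr 1
      push_cast
      ring
    rw [hk, hk, e1, e2]
  · intro h
    simp [h]

/-- The two binomials at `r` have no common prime factor: it would divide both its derivatives. -/
theorem not_dvd_binom_binom {p : Laurent₂} (hp : Prime p) (r : ℝ × ℝ)
    (h1 : p ∣ binom (1, 0) r) (h2 : p ∣ binom (0, 1) r) : False := by
  -- If the binomial is `p * g`, then `ℓ'` kills it, so `p ∣ der ℓ' p * g`. And `p ∤ g`, because `ℓ`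
  -- sends the binomial to a unit.
  have key : ∀ (ℓ ℓ' : ℤ × ℤ →+ ℤ) (k : ℤ × ℤ), ℓ k = 1 → ℓ' k = 0 → p ∣ binom k r →
      p ∣ der ℓ' p := by
    rintro ℓ ℓ' k hk hk' ⟨g, hg⟩
    have e1 : der ℓ (binom k r) = single k 1 := by simp [binom, hk]
    have e2 : der ℓ' (binom k r) = 0 := by simp [binom, hk']
    rw [hg, der_mul] at e1 e2
    have hdvd : p ∣ der ℓ' p * g := by
      rw [eq_neg_of_add_eq_zero_left e2]
      exact (dvd_mul_right _ _).neg_right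
    refine (hp.dvd_or_dvd hdvd).resolve_right fun hpg => hp.not_isUnit ?_
    refine isUnit_of_dvd_unit ?_ (isUnit_single k one_ne_zero)
    rw [← e1]
    exact dvd_add (hpg.mul_left _) (dvd_mul_right _ _)
  exact hp.not_isUnit (isUnit_of_dvd_der hp.ne_zero
    (key (AddMonoidHom.snd ℤ ℤ) _ _ rfl rfl h2) (key (AddMonoidHom.fst ℤ ℤ) _ _ rfl rfl h1))

/-- By pigeonhole, `p` divides `pointPoly` at one point for two values of `n`, hence both of its
summands and both binomials. -/
theorem not_forall_dvd_prod_pointPoly {p : Laurent₂} (hp : Prime p) (S : Finset (ℝ × ℝ)) :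
    ¬ ∀ n : ℕ, p ∣ ∏ r ∈ S, pointPoly n r := by
  intro h
  choose r hrS hr using fun n => hp.exists_mem_finset_dvd (h n)
  obtain ⟨m, n, hmn, he⟩ := Finite.exists_ne_map_eq_of_infinite (fun n => (⟨r n, hrS n⟩ : S))
  have he : r m = r n := congrArg Subtype.val he
  have hm := hr m
  have hn := hr n
  rw [he] at hm
  have h1 : p ∣ ((m : ℂ) - n) • absSq (0, 1) (r n) := by
    have := dvd_sub hm hn
    rwa [pointPoly, pointPoly, add_sub_add_left_eq_sub, ← sub_smul, add_sub_add_right_eq_sub]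
      at this
  have h0 : (m : ℂ) - n ≠ 0 := sub_ne_zero.2 (by exact_mod_cast hmn)
  have h2 : p ∣ absSq (0, 1) (r n) := by
    have := dvd_smul_of_dvd ((m : ℂ) - n)⁻¹ h1
    rwa [smul_smul, inv_mul_cancel₀ h0, one_smul] at this
  have h3 : p ∣ absSq (1, 0) (r n) :=
    (dvd_add_left (dvd_smul_of_dvd _ h2)).1 hn
  exact not_dvd_binom_binom hp _ (dvd_binom_of_dvd_absSq hp h3) (dvd_binom_of_dvd_absSq hp h2)

theorem zeros_mul (f g : Laurent₂) : zeros (f * g) = zeros f ∪ zeros g := by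
  ext r
  simp only [zeros, Set.mem_ofPred_eq, Set.mem_union, map_mul, mul_eq_zero]
  tauto

theorem zeros_prod_pointPoly {p : Laurent₂} (hp : (zeros p).Finite) (n : ℕ) :
    zeros (∏ r ∈ hp.toFinset, pointPoly n r) = zeros p := by
  ext s
  simp only [zeros, Set.mem_ofPred_eq, map_prod, Finset.prod_eq_zero_iff, Set.Finite.mem_toFinset,
    ev_pointPoly_eq_zero]
  refine and_congr_right fun hs => ⟨?_, fun h => ⟨s, ⟨hs, h⟩, rfl⟩⟩
  rintro ⟨r, ⟨-, hr⟩, hsr⟩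
  rw [hsr, hr]

/-! ### Consequences of minimality -/

/-- A Laurent polynomial that divides all those with the same zero set is squarefree. -/
theorem squarefree_of_minimal {m : Laurent₂} (hm0 : m ≠ 0)
    (hm : ∀ f, zeros f = zeros m → m ∣ f) : Squarefree m := by
  rw [squarefree_iff_irreducible_sq_not_dvd_of_ne_zero hm0]
  rintro p hp ⟨q, rfl⟩
  have h := hm (p * q) (by rw [zeros_mul, zeros_mul, zeros_mul, Set.union_self])
  rw [mul_assoc] at h
  have h0 : p * q ≠ 0 := fun h0 => hm0 (by rw [mul_assoc, h0, mul_zero])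
  exact hp.not_isUnit (isUnit_of_dvd_one ((mul_dvd_mul_iff_right h0).1 (by rwa [one_mul])))

/-- If `p` had finitely many zeros, the product of `pointPoly n` over them could replace `p` in `m`,
for every `n`. Minimality would make `p` divide all these products. -/
theorem infinite_zeros_of_minimal {m : Laurent₂} (hm0 : m ≠ 0)
    (hm : ∀ f, zeros f = zeros m → m ∣ f) {p : Laurent₂} (hp : Prime p) (hpm : p ∣ m) :
    (zeros p).Infinite := by
  intro hfin
  obtain ⟨q, rfl⟩ := hpm
  refine not_forall_dvd_prod_pointPoly hp hfin.toFinset fun n => ?_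
  refine (mul_dvd_mul_iff_right (right_ne_zero_of_mul hm0)).1 (hm _ ?_)
  rw [zeros_mul, zeros_mul, zeros_prod_pointPoly]

theorem dvd_of_squarefree {R : Type*} [CommRing R] [IsDomain R] [UniqueFactorizationMonoid R]
    {m f : R} (hm0 : m ≠ 0) (hm : Squarefree m) (h : ∀ p, Prime p → p ∣ m → p ∣ f) : m ∣ f := by
  induction m using UniqueFactorizationMonoid.induction_on_prime with
  | h₁ => exact absurd rfl hm0
  | h₂ x hx => exact hx.dvd
  | h₃ a p ha hp ih =>
    obtain ⟨g, rfl⟩ := ih ha (hm.of_mul_right) fun q hq hqa => h q hq (hqa.mul_left _)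
    have hpa : ¬ p ∣ a := fun hpa => hp.not_isUnit (hm p (mul_dvd_mul_left p hpa))
    have hpg := (hp.dvd_or_dvd (h p hp (dvd_mul_right _ _))).resolve_left hpa
    rw [mul_comm p a]
    exact mul_dvd_mul_left a hpg

/-- A prime factor of a squarefree Laurent polynomial divides every `g` whose products with both
derivatives it divides. -/
theorem dvd_of_dvd_der_mul {m p g : Laurent₂} (hm : Squarefree m) (hp : Prime p) (hpm : p ∣ m)
    (h1 : p ∣ der (AddMonoidHom.fst ℤ ℤ) m * g) (h2 : p ∣ der (AddMonoidHom.snd ℤ ℤ) m * g) :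
    p ∣ g := by
  obtain ⟨q, rfl⟩ := hpm
  have hpq : ¬ p ∣ q := fun hpq => hp.not_isUnit (hm p (mul_dvd_mul_left p hpq))
  by_contra hpg
  have key : ∀ ℓ, p ∣ der ℓ (p * q) * g → p ∣ der ℓ p := by
    intro ℓ h
    have h := (hp.dvd_or_dvd h).resolve_right hpg
    rw [der_mul] at h
    exact (hp.dvd_or_dvd ((dvd_add_left (dvd_mul_right _ _)).1 h)).resolve_right hpq
  exact hp.not_isUnit (isUnit_of_dvd_der hp.ne_zero (key _ h1) (key _ h2))

theorem dvd_of_minimal {m : Laurent₂} (hm0 : m ≠ 0) (hm : ∀ f, zeros f = zeros m → m ∣ f)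
    {p f : Laurent₂} (hp : Prime p) (hpm : p ∣ m) (hf : zeros m ⊆ zeros f) : p ∣ f := by
  by_contra hpf
  refine infinite_zeros_of_minimal hm0 hm hp hpm ?_
  have hsub : zeros p ⊆ zeros m := by
    obtain ⟨q, rfl⟩ := hpm
    rw [zeros_mul]
    exact Set.subset_union_left
  exact (finite_zeros_inter hp hpf).subset fun r hr => ⟨hr, hf (hsub hr)⟩

theorem sq_dvd_of_minimal {m : Laurent₂} (hm0 : m ≠ 0) (hm : ∀ f, zeros f = zeros m → m ∣ f)
    {f : Laurent₂} (hf : zeros m ⊆ zeros f)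
    (h1 : zeros m ⊆ zeros (der (AddMonoidHom.fst ℤ ℤ) f))
    (h2 : zeros m ⊆ zeros (der (AddMonoidHom.snd ℤ ℤ) f)) : m ^ 2 ∣ f := by
  have hsq := squarefree_of_minimal hm0 hm
  obtain ⟨g, rfl⟩ := dvd_of_squarefree hm0 hsq fun p hp hpm => dvd_of_minimal hm0 hm hp hpm hf
  rw [sq]
  refine mul_dvd_mul_left m (dvd_of_squarefree hm0 hsq fun p hp hpm => ?_)
  have key : ∀ ℓ, zeros m ⊆ zeros (der ℓ (m * g)) → p ∣ der ℓ m * g := by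
    intro ℓ h
    have h := dvd_of_minimal hm0 hm hp hpm h
    rw [der_mul] at h
    exact (dvd_add_left (hpm.mul_right _)).1 h
  exact dvd_of_dvd_der_mul hsq hp hpm (key _ h1) (key _ h2)

theorem finite_zeros_of_forall_prime {m : Laurent₂} (hm0 : m ≠ 0) {S : Set (ℝ × ℝ)}
    (h : ∀ p, Prime p → p ∣ m → (zeros p ∩ S).Finite) : (zeros m ∩ S).Finite := by
  induction m using UniqueFactorizationMonoid.induction_on_prime with
  | h₁ => exact absurd rfl hm0
  | h₂ x hx =>
    refine Set.finite_empty.subset ?_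
    rintro r ⟨⟨-, hr⟩, -⟩
    exact (hx.map (ev r)).ne_zero hr
  | h₃ a p ha hp ih =>
    rw [zeros_mul, Set.union_inter_distrib_right]
    exact (h p hp (dvd_mul_right _ _)).union
      (ih ha fun q hq hqa => h q hq (hqa.mul_left _))

theorem finite_singular_of_squarefree {m : Laurent₂} (hm0 : m ≠ 0) (hm : Squarefree m) :
    (zeros m ∩ (zeros (der (AddMonoidHom.fst ℤ ℤ) m) ∩
      zeros (der (AddMonoidHom.snd ℤ ℤ) m))).Finite := by
  refine finite_zeros_of_forall_prime hm0 fun p hp hpm => ?_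
  by_cases h1 : p ∣ der (AddMonoidHom.fst ℤ ℤ) m
  · by_cases h2 : p ∣ der (AddMonoidHom.snd ℤ ℤ) m
    -- Taking `g = 1` would give `p ∣ 1`.
    · exact absurd (isUnit_of_dvd_one (dvd_of_dvd_der_mul hm hp hpm (h1.mul_right 1)
        (h2.mul_right 1))) hp.not_isUnit
    · exact (finite_zeros_inter hp h2).subset fun r hr => ⟨hr.1, hr.2.2⟩
  · exact (finite_zeros_inter hp h1).subset fun r hr => ⟨hr.1, hr.2.1⟩

theorem zeros_ofCoeff (μ : TrigPoly) : zeros (ofCoeff μ.coeff) = μ.zeroSet := by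
  simp only [zeros, TrigPoly.zeroSet, ev_ofCoeff]

end Laurent₂

open Laurent₂ AddMonoidAlgebra in
theorem mainTheorem6 (C : Set (ℝ × ℝ)) (hC : TrigPoly.IsTrigCurve C)
    (μ₀ : TrigPoly) (hμ₀ : TrigPoly.IsMinimalPoly C μ₀) :
    (∀ ν : TrigPoly, (∀ r ∈ C, ν.eval r = 0 ∧ TrigPoly.grad ν.eval r = 0) →
      TrigPoly.Divides (fun r => μ₀.eval r ^ 2) ν.eval) ∧
    {r : ℝ × ℝ | r ∈ C ∧ TrigPoly.grad μ₀.eval r = 0}.Finite := by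
  obtain ⟨rfl, hmin⟩ := hμ₀
  set m : Laurent₂ := ofCoeff μ₀.coeff with hmdef
  have hmz : μ₀.zeroSet = zeros m := (zeros_ofCoeff μ₀).symm
  have hm : ∀ f, zeros f = zeros m → m ∣ f := by
    intro f hf
    obtain ⟨γ, hγ⟩ := (hmin ⟨f.coeff⟩ (by rw [← zeros_ofCoeff, hmz, ← hf])).2
    refine ⟨ofCoeff γ.coeff, eq_of_ev fun r => ?_⟩
    rw [map_mul, ev_ofCoeff, ev_ofCoeff, ← hγ, ← ev_ofCoeff]
  -- Zero divides only zero, but `C` is cut out by some nonzero polynomial.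
  have hm0 : m ≠ 0 := by
    obtain ⟨μ, hμ0, hμ⟩ := hC
    intro h0
    have h := hm (ofCoeff μ.coeff) (by rw [zeros_ofCoeff, hμ, hmz])
    rw [h0, zero_dvd_iff] at h
    exact hμ0 (coeff_eq_zero.2 h)
  rw [hmz]
  refine ⟨fun ν hν => ?_, ?_⟩
  · obtain ⟨g, hg⟩ := sq_dvd_of_minimal hm0 hm (f := ofCoeff ν.coeff)
      (fun r hr => ⟨hr.1, (ev_ofCoeff ν r).trans (hν r hr).1⟩)
      (fun r hr => ⟨hr.1, ((grad_eq_zero_iff ν r).1 (hν r hr).2).1⟩)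
      (fun r hr => ⟨hr.1, ((grad_eq_zero_iff ν r).1 (hν r hr).2).2⟩)
    refine ⟨⟨g.coeff⟩, fun r => ?_⟩
    rw [← ev_ofCoeff, hg, map_mul, map_pow, hmdef, ev_ofCoeff, ← ev_ofCoeff ⟨g.coeff⟩]
  · refine (finite_singular_of_squarefree hm0 (squarefree_of_minimal hm0 hm)).subset ?_
    rintro r ⟨hr, hgr⟩
    have := (grad_eq_zero_iff μ₀ r).1 hgr
    exact ⟨hr, ⟨hr.1, this.1⟩, ⟨hr.1, this.2⟩⟩
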